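/- Let $(\Omega,\mathcal F,(\mathcal F_t)_{t\ge 0},\mathsf P_0)$ be a filtered probability space carrying a standard one-dimensional $(\mathcal F_t)$-Brownian motion $B$ with continuous paths. Let $b\in\mathbb R$, $\sigma>0$, $r>0$, $\alpha\in(0,1)$, $\kappa>0$, and for $x>0$ let $X^x_t=x\exp\big((b-\tfrac12\sigma^2)t+\sigma B_t\big)$, $t\ge 0$. For a constant $\xi\in\mathbb R$ let $\mathsf P^\xi$ be the prior with Girsanov kernel $\xi$, i.e. $\frac{d\mathsf P^\xi}{d\mathsf P_0}\big|_{\mathcal F_t}=\exp\big(\xi B_t-\tfrac12\xi^2t\big)$ for all $t\ge 0$, with expectation $\mathsf E^\xi$; for a nonnegative adapted process $Y$ with continuous paths, $\mathsf E^\xi\big[\int_0^\infty Y_s\,ds\big]$ is understood as $\sup_{T\ge 0}\mathsf E^\xi\big[\int_0^T Y_s\,ds\big]$, so that only the restrictions of $\mathsf P^\xi$ to the $\sigma$-algebras $\mathcal F_T$ are used. Define $$K_\xi:=\mathsf E^\xi\Big[\int_0^\infty e^{-rs}\inf_{0\le u\le s}\Big(\frac{X^1_s}{X^1_u}\Big)^\alpha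 ds\Big].$$ Then $K_\xi<\infty$ for every $\xi\in[-\kappa,\kappa]$, and for all constants $\xi^1,\xi^2\in[-\kappa,\kappa]$ with $\xi^1\le\xi^2$ one has $K_{\xi^1}\le K_{\xi^2}$. Moreover, if $\xi\in[-\kappa,\kappa]$ and $\mathsf P^\xi$ exists as a measure on all of $\mathcal F$ with the above densities on every $\mathcal F_t$, then $K_\xi$ equals the ordinary expectation of the above integral under that measure. Consequently, investment decreases with ambiguity: for a level of ambiguity $\kappa'>0$, an initial shock $x>0$ and an initial capacity $c\ge 0$, let $$I^{\star,-\kappa'}_t:=\sup_{0\le s\le t}\big((K_{-\kappa'})^{1/\alpha}X^x_s-c\big)\vee 0,\qquad t\ge 0,$$ be the base-capacity investment plan. If $0<\kappa_1\le\kappa_2$, then $I^{\star,-\kappa_2}_t\le I^{\star,-\kappa_1}_t$ for all $t\ge 0$, on every path. -/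

import Mathlib

open MeasureTheory ProbabilityTheory Set
open scoped NNReal ENNReal

namespace KappaIgnorance

/-- `B` is a standard one-dimensional Brownian motion on the filtered probability space
`(Ω, 𝓕, P₀)`: it has the Brownian finite-dimensional laws, continuous paths, is adapted, and its
increments after time `s` are independent of `𝓕 s`. -/
structure IsFilteredBrownian {Ω : Type*} {mΩ : MeasurableSpace Ω} (𝓕 : Filtration ℝ≥0 mΩ)
    (B : ℝ≥0 → Ω → ℝ) (P₀ : Measure Ω) : Prop where
  isPreBrownian : IsPreBrownianReal B P₀
  continuous_paths : ∀ ω, Continuous fun t => B t ω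
  adapted : ∀ t, Measurable[𝓕 t] (B t)
  indep_increments : ∀ s t, s ≤ t →
    Indep (MeasurableSpace.comap (fun ω => B t ω - B s ω) inferInstance) (𝓕 s) P₀

variable {Ω : Type*} {mΩ : MeasurableSpace Ω}

/-- The economic shock `X^x_t = x exp((b - σ²/2) t + σ B_t)`. -/
noncomputable def shock (B : ℝ≥0 → Ω → ℝ) (b σ x : ℝ) (t : ℝ≥0) (ω : Ω) : ℝ :=
  x * Real.exp ((b - σ ^ 2 / 2) * (t : ℝ) + σ * B t ω)

/-- The Girsanov density `ε^ξ_t = exp(∫₀ᵗ ξ dB - ½ ∫₀ᵗ ξ² ds)` for a constant kernel `ξ`. -/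
noncomputable def girsanovDensity (B : ℝ≥0 → Ω → ℝ) (ξ : ℝ) (t : ℝ≥0) (ω : Ω) : ℝ :=
  Real.exp (ξ * B t ω - ξ ^ 2 * (t : ℝ) / 2)

/-- The measure `ε^ξ_T · P₀`; on the events of `𝓕 T` it is the prior `P^ξ`. -/
noncomputable def priorUpTo (P₀ : Measure Ω) (B : ℝ≥0 → Ω → ℝ) (ξ : ℝ) (T : ℝ≥0) : Measure Ω :=
  P₀.withDensity fun ω => ENNReal.ofReal (girsanovDensity B ξ T ω)

/-- `Q` is a prior `P^ξ` on all of `Ω`: `dQ/dP₀ = ε^ξ_t` on `𝓕 t` for every `t ≥ 0`. -/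
def IsPrior (𝓕 : Filtration ℝ≥0 mΩ) (P₀ : Measure Ω) (B : ℝ≥0 → Ω → ℝ) (ξ : ℝ)
    (Q : Measure Ω) : Prop :=
  ∀ (t : ℝ≥0) (A : Set Ω), MeasurableSet[𝓕 t] A → Q A = priorUpTo P₀ B ξ t A

/-- `E^ξ[∫₀^∞ Y_s ds]` for a nonnegative adapted process `Y`. As `P^ξ` is prescribed on each `𝓕 T`
through the density `ε^ξ_T`, this is the limit (supremum) over `T` of `E^ξ[∫₀^T Y_s ds]`, each of
which is an expectation under `ε^ξ_T · P₀`. -/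
noncomputable def priorExpIntegral (P₀ : Measure Ω) (B : ℝ≥0 → Ω → ℝ) (ξ : ℝ)
    (Y : ℝ≥0 → Ω → ℝ≥0∞) : ℝ≥0∞ :=
  ⨆ T : ℝ≥0, ∫⁻ ω, (∫⁻ s in Icc (0 : ℝ) T, Y s.toNNReal ω) ∂(priorUpTo P₀ B ξ T)

/-- The integrand `e^{-rs} inf_{0 ≤ u ≤ s} (X¹_s / X¹_u)^α`. -/
noncomputable def discountedInf (B : ℝ≥0 → Ω → ℝ) (b σ r α : ℝ) (s : ℝ≥0) (ω : Ω) : ℝ≥0∞ :=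
  ENNReal.ofReal (Real.exp (-r * (s : ℝ)) *
    ⨅ u : Icc (0 : ℝ≥0) s, (shock B b σ 1 s ω / shock B b σ 1 (u : ℝ≥0) ω) ^ α)

/-- `K_ξ = E^ξ[∫₀^∞ e^{-rs} inf_{0 ≤ u ≤ s} (X¹_s / X¹_u)^α ds]`. -/
noncomputable def Kconst (P₀ : Measure Ω) (B : ℝ≥0 → Ω → ℝ) (b σ r α ξ : ℝ) : ℝ≥0∞ :=
  priorExpIntegral P₀ B ξ (discountedInf B b σ r α)

/-- The base-capacity investment plan under `κ`-ignorance, with initial shock `x` and initial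
capacity `c`: `I_t = sup_{0 ≤ s ≤ t} (K X^x_s - c) ∨ 0`, where `K = (K_{-κ})^{1/α}`. -/
noncomputable def investmentPlan (P₀ : Measure Ω) (B : ℝ≥0 → Ω → ℝ) (b σ r α κ x c : ℝ)
    (t : ℝ≥0) (ω : Ω) : ℝ :=
  max (⨆ s : Icc (0 : ℝ≥0) t,
    ((Kconst P₀ B b σ r α (-κ)).toReal ^ (1 / α) * shock B b σ x (s : ℝ≥0) ω - c)) 0

end KappaIgnorance

/-! Under `ε^ξ_T · P₀` the path of `B` on `[0, T]` has the law of `B_t + ξ t`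
(`map_path_priorUpTo`). Hence for `s ≤ T` the prior expectation of the integrand is a
`P₀`-expectation with `b` replaced by `b + σ ξ`, free of `T` (`lintegral_discountedInf_priorUpTo`),
and Tonelli turns `K_ξ` into a time integral of these (`Kconst_eq_setLIntegral`). All `K_ξ` now live
under one measure, and comparison is pathwise: the log-ratio `α((b - σ²/2)(s - u) + σ(B_s - B_u))`
increases with the drift because `u ≤ s`. Taking `u = s` bounds the infimum by 1, so `e^{-rs}`
dominates and `K_ξ` is finite. The investment plan inherits monotonicity from `K_{-κ}`, as the shock
is positive. -/

namespace KappaIgnorance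

/-! ### Exponential tilting of Gaussian variables -/

section GaussianShift

variable {Ω : Type*} {mΩ : MeasurableSpace Ω} {P : Measure Ω} {Y Z : Ω → ℝ}

lemma hasGaussianLaw_const_mul_add (h : HasGaussianLaw (fun ω => (Y ω, Z ω)) P) (a : ℝ) :
    HasGaussianLaw (fun ω => a * Y ω + Z ω) P := by
  have := h.map (a • ContinuousLinearMap.fst ℝ ℝ ℝ + ContinuousLinearMap.snd ℝ ℝ ℝ)
  exact this

/-- The exponential moment of a Gaussian variable. -/
lemma integral_exp_of_hasGaussianLaw {X : Ω → ℝ} (h : HasGaussianLaw X P) :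
    ∫ ω, Real.exp (X ω) ∂P = Real.exp (P[X] + Var[X; P] / 2) := by
  have := mgf_gaussianReal h.map_eq_gaussianReal 1
  simpa [mgf, Real.coe_toNNReal _ (variance_nonneg X P)] using this

lemma integrable_exp_of_hasGaussianLaw {X : Ω → ℝ} (h : HasGaussianLaw X P) :
    Integrable (fun ω => Real.exp (X ω)) P := by
  -- A nonintegrable function has integral 0 by convention, but the formula gives a positive value.
  by_contra hc
  have := integral_undef hc
  rw [integral_exp_of_hasGaussianLaw h] at this
  exact (Real.exp_pos _).ne' this

lemma integral_exp_const_mul_add (h : HasGaussianLaw (fun ω => (Y ω, Z ω)) P) (hZ : P[Z] = 0)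
    (t : ℝ) :
    ∫ ω, Real.exp (t * Y ω + Z ω) ∂P
      = Real.exp (t * P[Y] + (t ^ 2 * Var[Y; P] + 2 * t * cov[Y, Z; P] + Var[Z; P]) / 2) := by
  have := h.fst.isProbabilityMeasure
  have hY2 : MemLp Y 2 P := h.fst.memLp_two
  have hZ2 : MemLp Z 2 P := h.snd.memLp_two
  rw [integral_exp_of_hasGaussianLaw (hasGaussianLaw_const_mul_add h t),
    integral_add (h.fst.integrable.const_mul t) h.snd.integrable, integral_const_mul, hZ,
    variance_fun_add (hY2.const_mul t) hZ2, variance_const_mul, covariance_const_mul_left]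
  congr 1
  ring

/-- Two laws on `ℝ` whose moment generating functions are everywhere finite and agree are equal. -/
lemma map_eq_map_of_mgf_eq {Ω' : Type*} {mΩ' : MeasurableSpace Ω'} {P' : Measure Ω'}
    [IsFiniteMeasure P] [IsFiniteMeasure P'] [NeZero P] [NeZero P'] {Y' : Ω' → ℝ}
    (hY : AEMeasurable Y P) (hY' : AEMeasurable Y' P')
    (hint : ∀ t, Integrable (fun ω => Real.exp (t * Y ω)) P) (h : mgf Y P = mgf Y' P') :
    P.map Y = P'.map Y' := by
  refine Measure.ext_of_complexMGF_eq hY hY' (funext fun z => ?_)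
  refine eqOn_complexMGF_of_mgf' h (by simp [NeZero.ne]) ?_
  have : integrableExpSet Y P = univ := eq_univ_of_forall hint
  simp [this]

/-- Weighting a Gaussian pair `(Y, Z)` by the exponential of the centered variable `Z` shifts the
law of `Y` by the covariance of `Y` and `Z`. -/
theorem map_withDensity_exp_eq (h : HasGaussianLaw (fun ω => (Y ω, Z ω)) P) (hZ : P[Z] = 0) :
    (P.withDensity fun ω => ENNReal.ofReal (Real.exp (Z ω - Var[Z; P] / 2))).map Y
      = P.map fun ω => Y ω + cov[Y, Z; P] := by
  have := h.fst.isProbabilityMeasure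
  have hexp (ω) : Real.exp (Z ω - Var[Z; P] / 2)
      = Real.exp (-(Var[Z; P] / 2)) * Real.exp (0 * Y ω + Z ω) := by
    rw [← Real.exp_add]; congr 1; ring
  have hmeas : AEMeasurable (fun ω => ENNReal.ofReal (Real.exp (Z ω - Var[Z; P] / 2))) P :=
    (Real.measurable_exp.comp_aemeasurable
      (h.snd.aemeasurable.sub_const _)).ennreal_ofReal
  have hdens : Integrable (fun ω => Real.exp (Z ω - Var[Z; P] / 2)) P := by
    simp_rw [hexp]
    exact (integrable_exp_of_hasGaussianLaw (hasGaussianLaw_const_mul_add h 0)).const_mul _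
  set ν := P.withDensity fun ω => ENNReal.ofReal (Real.exp (Z ω - Var[Z; P] / 2)) with hν
  have hfin : IsFiniteMeasure ν := isFiniteMeasure_withDensity_ofReal hdens.2
  have hsmul (t : ℝ) (ω : Ω) : (ENNReal.ofReal (Real.exp (Z ω - Var[Z; P] / 2))).toReal
      • Real.exp (t * Y ω) = Real.exp (-(Var[Z; P] / 2)) * Real.exp (t * Y ω + Z ω) := by
    rw [ENNReal.toReal_ofReal (Real.exp_pos _).le, smul_eq_mul, ← Real.exp_add, ← Real.exp_add]
    congr 1; ring
  have hint (t : ℝ) : Integrable (fun ω => Real.exp (t * Y ω)) ν := by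
    rw [hν, integrable_withDensity_iff_integrable_smul₀' hmeas (by simp)]
    simp_rw [hsmul]
    exact (integrable_exp_of_hasGaussianLaw (hasGaussianLaw_const_mul_add h t)).const_mul _
  have hmgf : mgf Y ν = mgf (fun ω => Y ω + cov[Y, Z; P]) P := by
    ext t
    rw [mgf_add_const, mgf_gaussianReal h.fst.map_eq_gaussianReal,
      Real.coe_toNNReal _ (variance_nonneg Y P), mgf, hν,
      integral_withDensity_eq_integral_toReal_smul₀ hmeas (by simp)]
    simp_rw [hsmul]
    rw [integral_const_mul, integral_exp_const_mul_add h hZ, ← Real.exp_add, ← Real.exp_add]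
    congr 1; ring
  -- The mgf at 0 is the total mass: 1 on the right, but 0 if `ν` vanished.
  have hne : NeZero ν := by
    refine ⟨fun h0 => ?_⟩
    have := congrFun hmgf 0
    rw [h0] at this
    simp at this
  exact map_eq_map_of_mgf_eq (h.fst.aemeasurable.mono_ac (withDensity_absolutelyContinuous _ _))
    (h.fst.aemeasurable.add_const _) hint hmgf

end GaussianShift

/-! ### Path law of Brownian motion under a constant Girsanov kernel -/

section CameronMartin

variable {Ω : Type*} {mΩ : MeasurableSpace Ω} {P₀ : Measure Ω} {B : ℝ≥0 → Ω → ℝ}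

/-- Adjoining `T` to the finitely many times makes the pair a linear image of a single Gaussian
vector. -/
lemma hasGaussianLaw_linear_prodMk (hB : IsPreBrownianReal B P₀) (ξ : ℝ) {T : ℝ≥0}
    (I : Finset (Iic T)) (L : StrongDual ℝ (I → ℝ)) :
    HasGaussianLaw (fun ω => (L (fun i => B i ω), ξ * B T ω)) P₀ := by
  classical
  let K : Finset ℝ≥0 := insert T (I.image Subtype.val)
  have hT : T ∈ K := Finset.mem_insert_self _ _
  have hI (i : I) : ((i : Iic T) : ℝ≥0) ∈ K :=
    Finset.mem_insert_of_mem (Finset.mem_image_of_mem _ i.2)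
  let φ : (K → ℝ) →L[ℝ] ℝ × ℝ :=
    (L.comp (ContinuousLinearMap.pi fun i => ContinuousLinearMap.proj ⟨i, hI i⟩)).prod
      (ξ • ContinuousLinearMap.proj (⟨T, hT⟩ : K))
  exact (hB.isGaussianProcess.hasGaussianLaw K).map φ

lemma dual_apply_eq_sum {ι : Type*} [Fintype ι] [DecidableEq ι] (L : StrongDual ℝ (ι → ℝ))
    (x : ι → ℝ) : L x = ∑ i, L (Pi.single i 1) * x i := by
  conv_lhs => rw [pi_eq_sum_univ' x, map_sum]
  simp [mul_comm, Pi.single]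

/-- Since `i ≤ T`, `cov(B_i, ξ B_T) = ξ min(i, T) = ξ i`: this is the drift produced by the tilt. -/
lemma covariance_linear_terminal (hB : IsPreBrownianReal B P₀) (ξ : ℝ) {T : ℝ≥0}
    (I : Finset (Iic T)) (L : StrongDual ℝ (I → ℝ)) :
    cov[fun ω => L (fun i => B i ω), fun ω => ξ * B T ω; P₀]
      = L (fun i => ξ * ((i : Iic T) : ℝ≥0)) := by
  classical
  have := hB.isGaussianProcess.isProbabilityMeasure
  have hmem (t : ℝ≥0) : MemLp (B t) 2 P₀ := (hB.isGaussianProcess.hasGaussianLaw_eval t).memLp_two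
  rw [dual_apply_eq_sum L]
  simp_rw [dual_apply_eq_sum L (fun i => B i _)]
  rw [covariance_fun_sum_left (fun i => (hmem _).const_mul _) ((hmem T).const_mul ξ)]
  refine Finset.sum_congr rfl fun i _ => ?_
  rw [covariance_const_mul_left, covariance_const_mul_right, hB.covariance_fun_eval,
    min_eq_left i.1.2]

lemma integral_const_mul_eval (hB : IsPreBrownianReal B P₀) (ξ : ℝ) (T : ℝ≥0) :
    ∫ ω, ξ * B T ω ∂P₀ = 0 := by
  rw [integral_const_mul, hB.integral_eval, mul_zero]

lemma variance_const_mul_eval (hB : IsPreBrownianReal B P₀) (ξ : ℝ) (T : ℝ≥0) :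
    Var[fun ω => ξ * B T ω; P₀] = ξ ^ 2 * T := by
  have := hB.isGaussianProcess.isProbabilityMeasure
  rw [variance_const_mul, (hB.hasLaw_eval T).variance_eq, variance_id_gaussianReal]

lemma priorUpTo_eq (hB : IsPreBrownianReal B P₀) (ξ : ℝ) (T : ℝ≥0) :
    priorUpTo P₀ B ξ T = P₀.withDensity fun ω =>
      ENNReal.ofReal (Real.exp (ξ * B T ω - Var[fun ω => ξ * B T ω; P₀] / 2)) := by
  rw [variance_const_mul_eval hB]; rfl

lemma map_linear_priorUpTo (hB : IsPreBrownianReal B P₀) (ξ : ℝ) {T : ℝ≥0}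
    (I : Finset (Iic T)) (L : StrongDual ℝ (I → ℝ)) :
    (priorUpTo P₀ B ξ T).map (fun ω => L (fun i => B i ω))
      = P₀.map fun ω => L (fun i => B i ω + ξ * ((i : Iic T) : ℝ≥0)) := by
  rw [priorUpTo_eq hB, map_withDensity_exp_eq (hasGaussianLaw_linear_prodMk hB ξ I L)
    (integral_const_mul_eval hB ξ T), covariance_linear_terminal hB]
  congr 1
  ext ω
  rw [← map_add]
  rfl

lemma isProbabilityMeasure_priorUpTo (hB : IsPreBrownianReal B P₀) (ξ : ℝ) (T : ℝ≥0) :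
    IsProbabilityMeasure (priorUpTo P₀ B ξ T) := by
  have := hB.isGaussianProcess.isProbabilityMeasure
  -- With no times and `L = 0`, the equality of laws compares total masses.
  have h := congrArg (· univ) (map_linear_priorUpTo hB ξ (T := T) ∅ 0)
  constructor
  simpa using h

/-- **Cameron–Martin**: up to time `T`, the path law of a Brownian motion `B` under `ε^ξ_T · P₀` is
the law of Brownian motion with drift `ξ`. -/
theorem map_path_priorUpTo (hB : IsPreBrownianReal B P₀) (hm : ∀ t, Measurable (B t)) (ξ : ℝ)
    (T : ℝ≥0) :
    (priorUpTo P₀ B ξ T).map (fun ω (t : Iic T) => B t ω)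
      = P₀.map fun ω (t : Iic T) => B t ω + ξ * (t : ℝ≥0) := by
  have := hB.isGaussianProcess.isProbabilityMeasure
  have := isProbabilityMeasure_priorUpTo hB ξ T
  have h1 : Measurable fun ω (t : Iic T) => B t ω := measurable_pi_lambda _ fun t => hm t
  have h2 : Measurable fun ω (t : Iic T) => B t ω + ξ * (t : ℝ≥0) :=
    measurable_pi_lambda _ fun t => (hm t).add_const _
  have e := isProjectiveLimit_map (P := priorUpTo P₀ B ξ T)
    (X := fun (t : Iic T) ω => B t ω) h1.aemeasurable
  have hI (I : Finset (Iic T)) :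
      (priorUpTo P₀ B ξ T).map (fun ω => I.restrict fun t : Iic T => B t ω)
        = P₀.map fun ω => I.restrict fun t : Iic T => B t ω + ξ * (t : ℝ≥0) := by
    have h1I : Measurable fun ω => I.restrict fun t : Iic T => B t ω :=
      (Finset.measurable_restrict I).comp h1
    have h2I : Measurable fun ω => I.restrict fun t : Iic T => B t ω + ξ * (t : ℝ≥0) :=
      (Finset.measurable_restrict I).comp h2
    -- Cramér–Wold: the laws of all linear functionals determine the finite-dimensional law; these
    -- in turn determine the path law.
    refine Measure.ext_of_charFunDual (funext fun L => ?_)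
    rw [charFunDual_eq_charFun_map_one, charFunDual_eq_charFun_map_one,
      Measure.map_map L.continuous.measurable h1I, Measure.map_map L.continuous.measurable h2I]
    exact congrArg (fun μ => charFun μ 1) (map_linear_priorUpTo hB ξ I L)
  simp_rw [hI] at e
  exact e.unique (isProjectiveLimit_map (X := fun (t : Iic T) ω => B t ω + ξ * (t : ℝ≥0))
    h2.aemeasurable)

end CameronMartin

/-! ### Measurability, drift shift and bounds for the integrand -/

section DiscountedInf

variable {Ω : Type*} {mΩ : MeasurableSpace Ω} {P₀ : Measure Ω} {B : ℝ≥0 → Ω → ℝ}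
  {b σ r α : ℝ}

lemma shock_div_rpow (B : ℝ≥0 → Ω → ℝ) (b σ α : ℝ) (s u : ℝ≥0) (ω : Ω) :
    (shock B b σ 1 s ω / shock B b σ 1 u ω) ^ α
      = Real.exp (α * ((b - σ ^ 2 / 2) * (s - u) + σ * (B s ω - B u ω))) := by
  simp only [shock, one_mul]
  rw [← Real.exp_sub, ← Real.exp_mul]
  congr 1
  ring

/-- A dense sequence in the unit interval. -/
noncomputable def unitDenseSeq : ℕ → Icc (0 : ℝ≥0) 1 := TopologicalSpace.denseSeq _

lemma unitDenseSeq_mul_le (n : ℕ) (s : ℝ≥0) : (unitDenseSeq n : ℝ≥0) * s ≤ s :=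
  mul_le_of_le_one_left zero_le (unitDenseSeq n).2.2

/-- The infimum of a continuous nonnegative function over `[0, s]` equals that along the dense
sequence of multiples of `s`. -/
lemma iInf_Icc_eq_iInf_unitDenseSeq {φ : ℝ≥0 → ℝ} (hφ : Continuous φ) (h0 : ∀ u, 0 ≤ φ u)
    (s : ℝ≥0) : ⨅ u : Icc (0 : ℝ≥0) s, φ u = ⨅ n, φ (unitDenseSeq n * s) := by
  have hne : Nonempty (Icc (0 : ℝ≥0) s) := ⟨⟨0, by simp⟩⟩
  refine le_antisymm (le_ciInf fun n => ?_) (le_ciInf fun u => ?_)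
  · exact ciInf_le (f := fun u : Icc (0 : ℝ≥0) s => φ u) ⟨0, by rintro _ ⟨u, rfl⟩; exact h0 _⟩
      ⟨unitDenseSeq n * s, zero_le, unitDenseSeq_mul_le n s⟩
  · have hbdd : BddBelow (range fun n => φ (unitDenseSeq n * s)) :=
      ⟨0, by rintro _ ⟨n, rfl⟩; exact h0 _⟩
    have key (v : Icc (0 : ℝ≥0) 1) : ⨅ n, φ (unitDenseSeq n * s) ≤ φ (v * s) := by
      refine (TopologicalSpace.denseRange_denseSeq (Icc (0 : ℝ≥0) 1)).induction_on
        (p := fun v : Icc (0 : ℝ≥0) 1 => ⨅ n, φ (unitDenseSeq n * s) ≤ φ (v * s)) v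
        (isClosed_le continuous_const (by fun_prop)) fun n => ciInf_le hbdd n
    rcases eq_or_ne s 0 with rfl | hs
    · have hu : (u : ℝ≥0) = 0 := le_antisymm u.2.2 u.2.1
      simp [hu]
    · have := key ⟨u / s, zero_le, div_le_one_of_le₀ u.2.2 zero_le⟩
      rwa [div_mul_cancel₀ _ hs] at this

/-- A countable infimum over times at most `s` yields joint measurability, adaptedness and a
measurable functional of the path. -/
lemma discountedInf_eq_iInf (hc : ∀ ω, Continuous fun t => B t ω) (s : ℝ≥0) (ω : Ω) :
    discountedInf B b σ r α s ω = ENNReal.ofReal (Real.exp (-r * s) *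
      ⨅ n, Real.exp (α * ((b - σ ^ 2 / 2) * (s - (unitDenseSeq n * s : ℝ≥0))
        + σ * (B s ω - B (unitDenseSeq n * s) ω)))) := by
  have := hc ω
  unfold discountedInf
  simp_rw [shock_div_rpow]
  rw [iInf_Icc_eq_iInf_unitDenseSeq (φ := fun u => Real.exp (α * ((b - σ ^ 2 / 2) * (s - u)
    + σ * (B s ω - B u ω)))) (by fun_prop) (fun u => (Real.exp_pos _).le)]

lemma measurable_uncurry_discountedInf (hc : ∀ ω, Continuous fun t => B t ω)
    (hm : ∀ t, Measurable (B t)) :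
    Measurable (Function.uncurry (discountedInf B b σ r α)) := by
  have hBm : Measurable (Function.uncurry B) :=
    measurable_uncurry_of_continuous_of_measurable hc hm
  have e : Function.uncurry (discountedInf B b σ r α) = fun p : ℝ≥0 × Ω =>
      ENNReal.ofReal (Real.exp (-r * p.1) *
        ⨅ n, Real.exp (α * ((b - σ ^ 2 / 2) * (p.1 - (unitDenseSeq n * p.1 : ℝ≥0))
        + σ * (Function.uncurry B p - Function.uncurry B (unitDenseSeq n * p.1, p.2))))) :=
    funext fun p => discountedInf_eq_iInf hc p.1 p.2
  rw [e]
  have hq (n : ℕ) : Measurable fun p : ℝ≥0 × Ω =>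
      Function.uncurry B (unitDenseSeq n * p.1, p.2) := hBm.comp (by fun_prop)
  refine ENNReal.measurable_ofReal.comp (Measurable.mul (by fun_prop) (Measurable.iInf fun n => ?_))
  have := hq n
  fun_prop

lemma measurable_discountedInf_filtration {𝓕 : Filtration ℝ≥0 mΩ}
    (hc : ∀ ω, Continuous fun t => B t ω) (ha : ∀ t, Measurable[𝓕 t] (B t)) (s : ℝ≥0) :
    Measurable[𝓕 s] (discountedInf B b σ r α s) := by
  rw [show discountedInf B b σ r α s = _ from funext fun ω => discountedInf_eq_iInf hc s ω]
  refine ENNReal.measurable_ofReal.comp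
    (Measurable.const_mul (Measurable.iInf fun n => Real.measurable_exp.comp ?_) _)
  have h1 := ha s
  have h2 : Measurable[𝓕 s] (B (unitDenseSeq n * s)) :=
    (ha _).mono (𝓕.mono (unitDenseSeq_mul_le n s)) le_rfl
  exact (((h1.sub h2).const_mul σ).const_add _).const_mul α

/-- The drift of `B` under the prior can be absorbed in the drift of the shock. -/
lemma lintegral_discountedInf_priorUpTo (hB : IsPreBrownianReal B P₀)
    (hc : ∀ ω, Continuous fun t => B t ω) (hm : ∀ t, Measurable (B t)) (ξ : ℝ) {s T : ℝ≥0}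
    (hs : s ≤ T) :
    ∫⁻ ω, discountedInf B b σ r α s ω ∂(priorUpTo P₀ B ξ T)
      = ∫⁻ ω, discountedInf B (b + σ * ξ) σ r α s ω ∂P₀ := by
  -- The integrand as a functional on path space, where the law of the path can be replaced.
  let H : (Iic T → ℝ) → ℝ≥0∞ := fun y => ENNReal.ofReal (Real.exp (-r * s) *
      ⨅ n, Real.exp (α * ((b - σ ^ 2 / 2) * (s - (unitDenseSeq n * s : ℝ≥0))
        + σ * (y ⟨s, hs⟩ - y ⟨unitDenseSeq n * s, (unitDenseSeq_mul_le n s).trans hs⟩))))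
  have hH : Measurable H :=
    ENNReal.measurable_ofReal.comp (Measurable.const_mul (Measurable.iInf fun n => by fun_prop) _)
  have h1 : Measurable fun ω (t : Iic T) => B t ω := measurable_pi_lambda _ fun t => hm t
  have h2 : Measurable fun ω (t : Iic T) => B t ω + ξ * (t : ℝ≥0) :=
    measurable_pi_lambda _ fun t => (hm t).add_const _
  calc ∫⁻ ω, discountedInf B b σ r α s ω ∂(priorUpTo P₀ B ξ T)
      = ∫⁻ ω, H (fun t => B t ω) ∂(priorUpTo P₀ B ξ T) :=
        lintegral_congr fun ω => discountedInf_eq_iInf hc s ω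
    _ = ∫⁻ y, H y ∂(P₀.map fun ω (t : Iic T) => B t ω + ξ * (t : ℝ≥0)) := by
        rw [← map_path_priorUpTo hB hm, lintegral_map hH h1]
    _ = ∫⁻ ω, H (fun t => B t ω + ξ * (t : ℝ≥0)) ∂P₀ := lintegral_map hH h2
    _ = ∫⁻ ω, discountedInf B (b + σ * ξ) σ r α s ω ∂P₀ := by
        refine lintegral_congr fun ω => ?_
        rw [discountedInf_eq_iInf hc s ω]
        simp only [H]
        congr 3 with n
        congr 2
        ring

lemma discountedInf_mono_drift (hα : 0 ≤ α) {b₁ b₂ : ℝ} (hb : b₁ ≤ b₂) (s : ℝ≥0) (ω : Ω) :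
    discountedInf B b₁ σ r α s ω ≤ discountedInf B b₂ σ r α s ω := by
  unfold discountedInf
  simp_rw [shock_div_rpow]
  gcongr with u
  · exact ⟨0, by rintro _ ⟨u, rfl⟩; exact (Real.exp_pos _).le⟩
  · exact sub_nonneg.2 (NNReal.coe_le_coe.2 u.2.2)

lemma discountedInf_le (s : ℝ≥0) (ω : Ω) :
    discountedInf B b σ r α s ω ≤ ENNReal.ofReal (Real.exp (-r * s)) := by
  unfold discountedInf
  simp_rw [shock_div_rpow]
  refine ENNReal.ofReal_le_ofReal (mul_le_of_le_one_right (Real.exp_pos _).le ?_)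
  have := ciInf_le (f := fun u : Icc (0 : ℝ≥0) s => Real.exp (α * ((b - σ ^ 2 / 2) *
    (s - (u : ℝ≥0)) + σ * (B s ω - B u ω))))
    ⟨0, by rintro _ ⟨u, rfl⟩; exact (Real.exp_pos _).le⟩ ⟨s, zero_le, le_rfl⟩
  simpa using this

end DiscountedInf

/-! ### Finiteness and monotonicity of `K_ξ`, and the investment plan -/

section Kconst

variable {Ω : Type*} {mΩ : MeasurableSpace Ω} {P₀ : Measure Ω} {𝓕 : Filtration ℝ≥0 mΩ}
  {B : ℝ≥0 → Ω → ℝ} {b σ r α : ℝ}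

lemma IsFilteredBrownian.measurable (hB : IsFilteredBrownian 𝓕 B P₀) (t : ℝ≥0) :
    Measurable (B t) := (hB.adapted t).mono (𝓕.le t) le_rfl

lemma lintegral_setLIntegral_discountedInf_swap (hB : IsFilteredBrownian 𝓕 B P₀) (Q : Measure Ω)
    [SFinite Q] (A : Set ℝ) :
    ∫⁻ ω, (∫⁻ s in A, discountedInf B b σ r α s.toNNReal ω) ∂Q
      = ∫⁻ s in A, ∫⁻ ω, discountedInf B b σ r α s.toNNReal ω ∂Q := by
  refine lintegral_lintegral_swap (Measurable.aemeasurable ?_)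
  exact (measurable_uncurry_discountedInf (b := b) (σ := σ) (r := r) (α := α)
    hB.continuous_paths hB.measurable).comp
    (f := fun p : Ω × ℝ => (p.2.toNNReal, p.1)) (by fun_prop)

lemma iSup_setLIntegral_Icc (g : ℝ → ℝ≥0∞) :
    ⨆ T : ℝ≥0, ∫⁻ s in Icc (0 : ℝ) T, g s = ∫⁻ s in Ici (0 : ℝ), g s := by
  refine le_antisymm (iSup_le fun T => lintegral_mono_set Icc_subset_Ici_self) ?_
  have hU : Ici (0 : ℝ) = ⋃ n : ℕ, Icc (0 : ℝ) n := by
    ext x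
    simp only [mem_Ici, mem_iUnion, mem_Icc]
    exact ⟨fun h => (exists_nat_ge x).imp fun n hn => ⟨h, hn⟩, fun ⟨_, h, _⟩ => h⟩
  rw [hU, setLIntegral_iUnion_of_directed g (Monotone.directed_le fun m n h =>
    Icc_subset_Icc_right (Nat.cast_le.2 h))]
  exact iSup_le fun n => le_iSup_of_le (n : ℝ≥0) (by simp)

/-- `K_ξ` is an integral over `[0, ∞)` of expectations under `P₀`, with the Girsanov kernel absorbed
in the drift of the shock. -/
theorem Kconst_eq_setLIntegral (hB : IsFilteredBrownian 𝓕 B P₀) (ξ : ℝ) :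
    Kconst P₀ B b σ r α ξ
      = ∫⁻ s in Ici (0 : ℝ), ∫⁻ ω, discountedInf B (b + σ * ξ) σ r α s.toNNReal ω ∂P₀ := by
  rw [← iSup_setLIntegral_Icc]
  refine iSup_congr fun T => ?_
  have := isProbabilityMeasure_priorUpTo hB.isPreBrownian ξ T
  rw [lintegral_setLIntegral_discountedInf_swap hB]
  refine setLIntegral_congr_fun measurableSet_Icc fun s hs => ?_
  exact lintegral_discountedInf_priorUpTo hB.isPreBrownian hB.continuous_paths hB.measurable ξ
    (Real.toNNReal_le_iff_le_coe.2 hs.2)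

lemma Kconst_lt_top [IsProbabilityMeasure P₀] (hB : IsFilteredBrownian 𝓕 B P₀) (hr : 0 < r)
    (ξ : ℝ) : Kconst P₀ B b σ r α ξ < ∞ := by
  rw [Kconst_eq_setLIntegral hB]
  calc ∫⁻ s in Ici (0 : ℝ), ∫⁻ ω, discountedInf B (b + σ * ξ) σ r α s.toNNReal ω ∂P₀
      ≤ ∫⁻ s in Ici (0 : ℝ), ENNReal.ofReal (Real.exp (-r * s)) := by
        refine setLIntegral_mono' measurableSet_Ici fun s hs => ?_
        calc ∫⁻ ω, discountedInf B (b + σ * ξ) σ r α s.toNNReal ω ∂P₀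
            ≤ ∫⁻ _, ENNReal.ofReal (Real.exp (-r * s)) ∂P₀ := by
              refine lintegral_mono fun ω => ?_
              simpa [Real.coe_toNNReal _ hs] using
                discountedInf_le (B := B) (b := b + σ * ξ) (σ := σ) (r := r) (α := α) s.toNNReal ω
          _ = ENNReal.ofReal (Real.exp (-r * s)) := by simp
    _ < ∞ := by
        have h : IntegrableOn (fun s => Real.exp (-r * s)) (Ici (0 : ℝ)) :=
          (integrableOn_Ici_iff_integrableOn_Ioi).2 (exp_neg_integrableOn_Ioi 0 hr)
        exact h.lintegral_lt_top

lemma Kconst_mono (hB : IsFilteredBrownian 𝓕 B P₀) (hσ : 0 ≤ σ) (hα : 0 ≤ α) :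
    Monotone (Kconst P₀ B b σ r α) := fun ξ₁ ξ₂ h => by
  rw [Kconst_eq_setLIntegral hB, Kconst_eq_setLIntegral hB]
  exact lintegral_mono fun s => lintegral_mono fun ω =>
    discountedInf_mono_drift hα (by gcongr) _ ω

lemma IsPrior.lintegral_eq {ξ : ℝ} {Q : Measure Ω} (hQ : IsPrior 𝓕 P₀ B ξ Q) (t : ℝ≥0)
    {f : Ω → ℝ≥0∞} (hf : Measurable[𝓕 t] f) :
    ∫⁻ ω, f ω ∂Q = ∫⁻ ω, f ω ∂(priorUpTo P₀ B ξ t) := by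
  have e : Q.trim (𝓕.le t) = (priorUpTo P₀ B ξ t).trim (𝓕.le t) := by
    refine @Measure.ext _ (𝓕 t) _ _ fun A hA => ?_
    rw [trim_measurableSet_eq _ hA, trim_measurableSet_eq _ hA, hQ t A hA]
  rw [← lintegral_trim (𝓕.le t) hf, e, lintegral_trim (𝓕.le t) hf]

/-- After Tonelli, the integrand at time `s` is `𝓕 s`-measurable, so `Q` may be replaced by `ε^ξ_s ·
P₀`, with horizon `T = s`. -/
lemma IsPrior.lintegral_discountedInf_eq_Kconst (hB : IsFilteredBrownian 𝓕 B P₀) {ξ : ℝ}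
    {Q : Measure Ω} (hQ : IsPrior 𝓕 P₀ B ξ Q) :
    ∫⁻ ω, (∫⁻ s in Ici (0 : ℝ), discountedInf B b σ r α s.toNNReal ω) ∂Q
      = Kconst P₀ B b σ r α ξ := by
  have hprob := isProbabilityMeasure_priorUpTo hB.isPreBrownian ξ 0
  have : IsProbabilityMeasure Q := ⟨by rw [hQ 0 univ MeasurableSet.univ, measure_univ]⟩
  rw [lintegral_setLIntegral_discountedInf_swap hB, Kconst_eq_setLIntegral hB]
  refine lintegral_congr fun s => ?_
  rw [hQ.lintegral_eq s.toNNReal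
      (measurable_discountedInf_filtration hB.continuous_paths hB.adapted _),
    lintegral_discountedInf_priorUpTo hB.isPreBrownian hB.continuous_paths hB.measurable ξ le_rfl]

lemma investmentPlan_antitone [IsProbabilityMeasure P₀] (hB : IsFilteredBrownian 𝓕 B P₀)
    (hσ : 0 ≤ σ) (hr : 0 < r) (hα : 0 ≤ α) {κ₁ κ₂ x : ℝ} (hκ : κ₁ ≤ κ₂) (hx : 0 ≤ x) (c : ℝ)
    (t : ℝ≥0) (ω : Ω) :
    investmentPlan P₀ B b σ r α κ₂ x c t ω ≤ investmentPlan P₀ B b σ r α κ₁ x c t ω := by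
  have hK : (Kconst P₀ B b σ r α (-κ₂)).toReal ≤ (Kconst P₀ B b σ r α (-κ₁)).toReal :=
    ENNReal.toReal_mono (Kconst_lt_top hB hr _).ne (Kconst_mono hB hσ hα (neg_le_neg hκ))
  have hcont : Continuous fun s : ℝ≥0 => shock B b σ x s ω := by
    have := hB.continuous_paths ω
    unfold shock
    fun_prop
  refine max_le_max (ciSup_mono ?_ fun s => ?_) le_rfl
  -- A real supremum is monotone only if the larger family is bounded above; here continuity on `[0,
  -- t]` ensures it.
  · have := (isCompact_Icc (a := (0 : ℝ≥0)) (b := t)).bddAbove_image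
      (f := fun s => (Kconst P₀ B b σ r α (-κ₁)).toReal ^ (1 / α) * shock B b σ x s ω - c)
      (by fun_prop)
    rwa [image_eq_range] at this
  · have hs : 0 ≤ shock B b σ x s ω := mul_nonneg hx (Real.exp_pos _).le
    gcongr

end Kconst

end KappaIgnorance

theorem lemma5p6 {Ω : Type*} {mΩ : MeasurableSpace Ω} (P₀ : Measure Ω) [IsProbabilityMeasure P₀]
    (𝓕 : Filtration ℝ≥0 mΩ) (B : ℝ≥0 → Ω → ℝ)
    (hB : KappaIgnorance.IsFilteredBrownian 𝓕 B P₀)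
    (b σ r α κ : ℝ) (hσ : 0 < σ) (hr : 0 < r) (hα : α ∈ Ioo (0 : ℝ) 1) (hκ : 0 < κ) :
    -- each `K_ξ` is a finite number
    (∀ ξ ∈ Icc (-κ) κ, KappaIgnorance.Kconst P₀ B b σ r α ξ < ∞) ∧
    -- `K_ξ` is nondecreasing in `ξ ∈ [-κ, κ]`
    (∀ ξ₁ ∈ Icc (-κ) κ, ∀ ξ₂ ∈ Icc (-κ) κ, ξ₁ ≤ ξ₂ →
      KappaIgnorance.Kconst P₀ B b σ r α ξ₁ ≤ KappaIgnorance.Kconst P₀ B b σ r α ξ₂) ∧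
    -- `K_ξ` is the expectation under any measure on `Ω` that is a prior `P^ξ`
    (∀ ξ ∈ Icc (-κ) κ, ∀ Q : Measure Ω, KappaIgnorance.IsPrior 𝓕 P₀ B ξ Q →
      ∫⁻ ω, (∫⁻ s in Ici (0 : ℝ), KappaIgnorance.discountedInf B b σ r α s.toNNReal ω) ∂Q
        = KappaIgnorance.Kconst P₀ B b σ r α ξ) ∧
    -- the base-capacity investment plan decreases as the ambiguity increases
    (∀ κ₁ κ₂ : ℝ, 0 < κ₁ → κ₁ ≤ κ₂ → ∀ x c : ℝ, 0 < x → 0 ≤ c → ∀ (t : ℝ≥0) (ω : Ω),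
      KappaIgnorance.investmentPlan P₀ B b σ r α κ₂ x c t ω
        ≤ KappaIgnorance.investmentPlan P₀ B b σ r α κ₁ x c t ω) := by

  exact ⟨fun ξ _ => KappaIgnorance.Kconst_lt_top hB hr ξ,
    fun ξ₁ _ ξ₂ _ h => KappaIgnorance.Kconst_mono hB hσ.le hα.1.le h,
    fun ξ _ Q hQ => hQ.lintegral_discountedInf_eq_Kconst hB,
    fun κ₁ κ₂ _ hκ x c hx _ t ω =>
      KappaIgnorance.investmentPlan_antitone hB hσ.le hr hα.1.le hκ hx.le c t ω⟩
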